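/- Let $k\ge 3$ and $n\ge 1$ be integers and let $\varepsilon\ge 0$. Let $\Theta=\{\theta\in[0,1]^{k-1}:\sum_{i=1}^{k-1}\theta_i\le 1\}$; for $\theta\in\Theta$ put $\theta_k=(1-\sum_{i=1}^{k-1}\theta_i)_+$, let $P_\theta=(\theta_1,\dots,\theta_k)$ be the corresponding probability distribution on $[k]=\{1,\dots,k\}$, and let $T(\theta)=-\sum_{i=1}^k\theta_i\log\theta_i$ be its entropy (natural logarithm, $0\log 0=0$). Let $X_1,\dots,X_n$ be i.i.d. samples from $P_\theta$, held by $n$ users. In a sequentially interactive $\varepsilon$-locally differentially private (LDP) protocol, user $i$ releases $Z_i$, with values in an arbitrary measurable space $\mathcal Z_i$, drawn from a probability kernel $\mathsf K_i(\cdot\mid X_i,Z_1,\dots,Z_{i-1})$ such that $\mathsf K_i(A\mid x,z^{i-1})\le e^{\varepsilon}\,\mathsf K_i(A\mid x',z^{i-1})$ for all measurable $A\subseteq\mathcal Z_i$, all $x,x'\in[k]$ and all $z^{i-1}=(z_1,\dots,z_{i-1})$. Define the private minimax risk under squared loss $$R^*=\inf_{\mathsf K_1,\dots,\mathsf K_n}\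 \inf_{\psi}\ \sup_{\theta\in\Theta}\ \mathbb E\big[(\psi(Z_1,\dots,Z_n)-T(\theta))^2\big],$$ where the infima are over all sequentially interactive $\varepsilon$-LDP protocols and all measurable real-valued estimators $\psi$. Then, with $\Upsilon_\varepsilon=\big(\frac{e^\varepsilon-1}{e^\varepsilon+1}\big)^2$, $$R^*\ \ge\ \frac1{20}\,\min\Big\{1,\frac{1}{100\,n\,\Upsilon_\varepsilon}\Big\}\,\log^2(k-1),$$ where for $\varepsilon=0$ (so $\Upsilon_\varepsilon=0$) the minimum is read as $1$. -/

import Mathlib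

open MeasureTheory ProbabilityTheory
open scoped ENNReal

universe u v w

/-- A sequentially interactive `ε`-locally differentially private protocol for `n` users, each
holding a sample in `X`. User `i` releases a random element of the measurable space `Z i`, drawn
from a Markov kernel which receives the sample `x` of user `i` together with the outputs
`z = (z_0, …, z_{i-1})` of the previous users. For every realization `z` of these outputs, the
mechanism `x ↦ K i (x, z)` is `ε`-LDP. -/
structure SeqLDPProtocol (X : Type v) [MeasurableSpace X] (n : ℕ) (ε : ℝ) where
  /-- The output space of user `i`. -/
  Z : Fin n → Type u
  [measurableSpaceZ : ∀ i, MeasurableSpace (Z i)]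
  /-- The mechanism of user `i`. -/
  K : (i : Fin n) → Kernel (X × ((j : Fin (i : ℕ)) → Z (j.castLE i.isLt.le))) (Z i)
  isMarkovKernel : ∀ i, IsMarkovKernel (K i)
  ldp : ∀ (i : Fin n) (z : (j : Fin (i : ℕ)) → Z (j.castLE i.isLt.le)) (x x' : X) (A : Set (Z i)),
    MeasurableSet A → K i (x, z) A ≤ ENNReal.ofReal (Real.exp ε) * K i (x', z) A

attribute [instance] SeqLDPProtocol.measurableSpaceZ

namespace SeqLDPProtocol

variable {X : Type v} [MeasurableSpace X] {n : ℕ} {ε : ℝ}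

/-- The space in which the first `i` outputs `(Z_0, …, Z_{i-1})` take their values. -/
abbrev Transcript (M : SeqLDPProtocol.{u, v} X n ε) (i : ℕ) (hi : i ≤ n) : Type u :=
  (j : Fin i) → M.Z (j.castLE hi)

/-- Append the output `z` of user `i` to the outputs `h` of the users before `i`. -/
def append (M : SeqLDPProtocol.{u, v} X n ε) (i : ℕ) (hi : i + 1 ≤ n)
    (h : M.Transcript i (Nat.le_of_succ_le hi)) (z : M.Z ⟨i, hi⟩) : M.Transcript (i + 1) hi :=
  Fin.snoc (α := fun j : Fin (i + 1) => M.Z (j.castLE hi)) h z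

/-- The joint law of the first `i` outputs when the samples are i.i.d. with law `P`: given the
first `i` outputs, draw a fresh sample `x` from `P`, independently of them, and then draw the
next output from the mechanism of user `i` at `x` and these outputs. -/
noncomputable def law (M : SeqLDPProtocol.{u, v} X n ε) (P : Measure X) :
    (i : ℕ) → (hi : i ≤ n) → Measure (M.Transcript i hi)
  | 0, _ => Measure.dirac (fun j => j.elim0)
  | i + 1, hi =>
    ((P.prod (M.law P i (Nat.le_of_succ_le hi))).compProd (M.K ⟨i, hi⟩)).map
      (fun w => M.append i hi w.1.2 w.2)

end SeqLDPProtocol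

/-- The private minimax risk: infimum over all sequentially interactive `ε`-LDP protocols for `n`
users and all measurable estimators `ψ` of the worst-case expected loss
`sup_{θ ∈ Θ} E[ℓ(ψ(Z^n), T(θ))]`, where the samples are i.i.d. from `P θ`. -/
noncomputable def privateMinimaxRisk {X : Type v} [MeasurableSpace X] {E : Type w}
    (n : ℕ) (Θ : Set E) (P : E → Measure X) (T : E → ℝ) (ℓ : ℝ → ℝ → ℝ) (ε : ℝ) : ℝ≥0∞ :=
  ⨅ (M : SeqLDPProtocol.{u, v} X n ε) (ψ : ((i : Fin n) → M.Z i) → ℝ) (_ : Measurable ψ),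
    ⨆ θ ∈ Θ, ∫⁻ z, ENNReal.ofReal (ℓ (ψ z) (T θ)) ∂(M.law (P θ) n le_rfl)

/-- The squared loss. -/
def squaredLoss (a b : ℝ) : ℝ := (a - b) ^ 2

/-- The parameters `θ ∈ [0,1]^{k-1}` with `∑ i, θ i ≤ 1`. -/
def simplexParam (k : ℕ) : Set (Fin (k - 1) → ℝ) :=
  {θ | (∀ i, θ i ∈ Set.Icc (0 : ℝ) 1) ∧ ∑ i, θ i ≤ 1}

/-- The probability vector `(θ_1, …, θ_{k-1}, (1 - ∑ θ_i)_+)` on `k` points. -/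
noncomputable def probVec (k : ℕ) (θ : Fin (k - 1) → ℝ) (j : Fin k) : ℝ :=
  if h : (j : ℕ) < k - 1 then θ ⟨j, h⟩ else max (1 - ∑ i, θ i) 0

/-- The distribution `P_θ` on `k` points. -/
noncomputable def discreteDist (k : ℕ) (θ : Fin (k - 1) → ℝ) : Measure (Fin k) :=
  ∑ j, ENNReal.ofReal (probVec k θ j) • Measure.dirac j

/-- The Shannon entropy (in nats) of `P_θ`. -/
noncomputable def entropyFunctional (k : ℕ) (θ : Fin (k - 1) → ℝ) : ℝ :=
  -∑ j, probVec k θ j * Real.log (probVec k θ j)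

/-- `Υ_ε = ((e^ε - 1) / (e^ε + 1))²`. -/
noncomputable def Upsilon (ε : ℝ) : ℝ := ((Real.exp ε - 1) / (Real.exp ε + 1)) ^ 2

/-! The proof is Le Cam's two-point method with a chi-square bound under privacy. Write m = k - 1
and let P_p put mass p on the last point and spread 1 - p uniformly over the other m. Its entropy is
h(p) + (1 - p) log m, and the binary entropy h is maximal at 1/2, so moving p from 1/2 to 1/2 + t
lowers the entropy by at least t log m.

These distributions are mixtures of A = P_0 and B = P_1. Privacy keeps the output laws under A and B
within a factor e^ε, so passing from p = 1/2 to 1/2 + t multiplies the output density by 1 + t d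
with |d| ≤ 2√Υ_ε (`exists_mixture_eq_withDensity`). The past transcript has the same conditional
role under A and B, so the term linear in d integrates to zero and each user multiplies the second
moment of the likelihood ratio by at most 1 + 4t²Υ_ε (`exists_density_stepLaw`). Induction over the
users handles interaction (`SeqLDPProtocol.exists_density_law`).

With 4t² = min{1, 1/(100 n Υ_ε)} the second moment stays below 1.02, and `two_point_lower_bound`
turns this into a risk of order t² log² m. -/

/-! ### Mixtures and their affine densities -/

/-- The mixture `(1/2 - t) A + (1/2 + t) B` of two measures. -/
noncomputable def mixture {X : Type*} [MeasurableSpace X] (A B : Measure X) (t : ℝ) : Measure X :=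
  ENNReal.ofReal (1 / 2 - t) • A + ENNReal.ofReal (1 / 2 + t) • B

lemma mixture_isProbabilityMeasure {X : Type*} [MeasurableSpace X] (A B : Measure X)
    [IsProbabilityMeasure A] [IsProbabilityMeasure B] {t : ℝ} (ht : |t| ≤ 1 / 2) :
    IsProbabilityMeasure (mixture A B t) := by
  obtain ⟨h1, h2⟩ := abs_le.mp ht
  constructor
  simp only [mixture, Measure.add_apply, Measure.smul_apply, measure_univ, smul_eq_mul, mul_one]
  rw [← ENNReal.ofReal_add (by linarith) (by linarith)]
  norm_num

lemma mixture_half {X : Type*} [MeasurableSpace X] (A B : Measure X) :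
    mixture A B (1 / 2) = B := by
  simp only [mixture]; norm_num

/-- If two finite measures are within a factor `r` of each other, then all their mixtures have
affine densities with respect to their average, with small slope. -/
lemma exists_mixture_eq_withDensity {Ω : Type*} [MeasurableSpace Ω] (α β : Measure Ω)
    [IsFiniteMeasure α] [IsFiniteMeasure β] {r : ℝ} (hr : 1 ≤ r)
    (hαβ : ∀ s, MeasurableSet s → α s ≤ ENNReal.ofReal r * β s)
    (hβα : ∀ s, MeasurableSet s → β s ≤ ENNReal.ofReal r * α s) :
    ∃ d : Ω → ℝ, Measurable d ∧ (∀ x, |d x| ≤ 2 * ((r - 1) / (r + 1))) ∧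
      ∀ t : ℝ, |t| ≤ 1 / 2 → mixture α β t =
        (mixture α β 0).withDensity (fun x => ENNReal.ofReal (1 + t * d x)) := by
  have hr0 : 0 < r + 1 := by linarith
  have hle : (r - 1) / (r + 1) ≤ 1 := by rw [div_le_one hr0]; linarith
  have hle0 : 0 ≤ (r - 1) / (r + 1) := div_nonneg (by linarith) hr0.le
  have hc1 : 1 / (r + 1) = (1 - (r - 1) / (r + 1)) / 2 := by field_simp; ring
  have hc2 : r / (r + 1) = (1 + (r - 1) / (r + 1)) / 2 := by field_simp; ring
  set q := (r - 1) / (r + 1) with hq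
  set σ := α + β with hσ
  have hac : α ≪ σ := Measure.absolutelyContinuous_of_le (Measure.le_add_right le_rfl)
  have hwd : σ.withDensity (α.rnDeriv σ) = α := Measure.withDensity_rnDeriv_eq _ _ hac
  have hset : ∀ s, MeasurableSet s → ∫⁻ x in s, α.rnDeriv σ x ∂σ = α s := fun s hs => by
    rw [← withDensity_apply _ hs, hwd]
  -- Adding r α to both sides of α ≤ r β gives (r + 1) α ≤ r (α + β); the lower bound comes from β ≤
  -- r α in the same way.
  have hup : α.rnDeriv σ ≤ᵐ[σ] fun _ => ENNReal.ofReal (r / (r + 1)) := by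
    refine ae_le_of_forall_setLIntegral_le_of_sigmaFinite (Measure.measurable_rnDeriv _ _)
      fun s hs _ => ?_
    rw [hset s hs, setLIntegral_const, hσ, Measure.add_apply, ← ENNReal.toReal_le_toReal
      (by finiteness) (by finiteness)]
    have h := ENNReal.toReal_mono (by finiteness) (hαβ s hs)
    rw [ENNReal.toReal_mul, ENNReal.toReal_ofReal (by linarith)] at h
    rw [ENNReal.toReal_mul, ENNReal.toReal_ofReal (by positivity),
      ENNReal.toReal_add (by finiteness) (by finiteness), div_mul_eq_mul_div, le_div_iff₀ hr0]
    linarith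
  have hlo : (fun _ => ENNReal.ofReal (1 / (r + 1))) ≤ᵐ[σ] α.rnDeriv σ := by
    refine ae_le_of_forall_setLIntegral_le_of_sigmaFinite measurable_const fun s hs _ => ?_
    rw [hset s hs, setLIntegral_const, hσ, Measure.add_apply, ← ENNReal.toReal_le_toReal
      (by finiteness) (by finiteness)]
    have h := ENNReal.toReal_mono (by finiteness) (hβα s hs)
    rw [ENNReal.toReal_mul, ENNReal.toReal_ofReal (by linarith)] at h
    rw [ENNReal.toReal_mul, ENNReal.toReal_ofReal (by positivity),
      ENNReal.toReal_add (by finiteness) (by finiteness), div_mul_eq_mul_div, div_le_iff₀ hr0]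
    linarith
  -- Clipping changes the derivative only on a null set and makes its bounds hold everywhere.
  set a : Ω → ℝ := fun x => max (1 / (r + 1)) (min (α.rnDeriv σ x).toReal (r / (r + 1))) with ha
  have ham : Measurable a := by
    have := Measure.measurable_rnDeriv α σ
    fun_prop
  have ha1 : ∀ x, (1 - q) / 2 ≤ a x := fun x => hc1 ▸ le_max_left _ _
  have ha2 : ∀ x, a x ≤ (1 + q) / 2 := fun x =>
    max_le (by linarith) ((min_le_right _ _).trans_eq hc2)
  have hα : α = σ.withDensity (fun x => ENNReal.ofReal (a x)) := by
    conv_lhs => rw [← hwd]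
    refine withDensity_congr_ae ?_
    filter_upwards [hup, hlo] with x hx1 hx2
    have hfin : α.rnDeriv σ x ≠ ∞ := ne_top_of_le_ne_top ENNReal.ofReal_ne_top hx1
    have h1 : (α.rnDeriv σ x).toReal ≤ r / (r + 1) :=
      ENNReal.toReal_le_of_le_ofReal (by positivity) hx1
    have h2 : 1 / (r + 1) ≤ (α.rnDeriv σ x).toReal :=
      (ENNReal.ofReal_le_iff_le_toReal hfin).mp hx2
    rw [ha]
    simp only
    rw [min_eq_left h1, max_eq_right h2, ENNReal.ofReal_toReal hfin]
  have hβ : β = σ.withDensity (fun x => ENNReal.ofReal (1 - a x)) := by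
    have hsum : α + σ.withDensity (fun x => ENNReal.ofReal (1 - a x)) = α + β := by
      conv_lhs => enter [1]; rw [hα]
      rw [← withDensity_add_left (by fun_prop), ← hσ]
      conv_rhs => rw [← withDensity_one (μ := σ)]
      congr 1
      ext x
      have := ha1 x; have := ha2 x
      simp only [Pi.add_apply, Pi.one_apply]
      rw [← ENNReal.ofReal_add (by linarith) (by linarith)]
      norm_num
    ext s hs
    have := congrArg (fun m => m s) hsum
    simp only [Measure.add_apply] at this
    exact ((ENNReal.add_right_inj (measure_ne_top α s)).mp this).symm
  have hmix : ∀ t : ℝ, |t| ≤ 1 / 2 → mixture α β t = σ.withDensity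
      (fun x => ENNReal.ofReal ((1 / 2 - t) * a x + (1 / 2 + t) * (1 - a x))) := fun t ht => by
    obtain ⟨h1, h2⟩ := abs_le.mp ht
    rw [mixture]
    conv_lhs => rw [hβ]; enter [1]; rw [hα]
    rw [← withDensity_smul _ (by fun_prop), ← withDensity_smul _ (by fun_prop),
      ← withDensity_add_left (by fun_prop)]
    congr 1
    ext x
    have := ha1 x; have := ha2 x
    simp only [Pi.add_apply, Pi.smul_apply, smul_eq_mul]
    rw [← ENNReal.ofReal_mul (by linarith), ← ENNReal.ofReal_mul (by linarith),
      ← ENNReal.ofReal_add (mul_nonneg (by linarith) (by linarith))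
        (mul_nonneg (by linarith) (by linarith))]
  -- From (1/2 - t) a + (1/2 + t)(1 - a) = (1/2)(1 + t · 2(1 - 2a)).
  refine ⟨fun x => 2 * (1 - 2 * a x), by fun_prop, fun x => ?_, fun t ht => ?_⟩
  · have := ha1 x; have := ha2 x
    rw [abs_le]; constructor <;> linarith
  · rw [hmix t ht, hmix 0 (by norm_num), ← withDensity_mul _ (by fun_prop) (by fun_prop)]
    congr 1
    ext x
    simp only [Pi.mul_apply]
    rw [← ENNReal.ofReal_mul (by linarith)]
    congr 1; ring

/-! ### One round of the protocol -/

section Step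

variable {X : Type*} {H : Type*} {Z : Type*} {W : Type*} [MeasurableSpace X] [MeasurableSpace H]
  [MeasurableSpace Z] [MeasurableSpace W]

/-- The law of the extended transcript `app h z`, where `h` is drawn from `m`, the sample `x` is
drawn from `P` independently of `h`, and `z` is drawn from `K (x, h)`. -/
noncomputable def stepLaw (K : Kernel (X × H) Z) (app : H → Z → W) (P : Measure X)
    (m : Measure H) : Measure W :=
  ((P.prod m).compProd K).map (fun w => app w.1.2 w.2)

variable {K : Kernel (X × H) Z} [IsMarkovKernel K] {app : H → Z → W} {init : W → H}
  {A B P : Measure X}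
  {m : Measure H}

lemma lintegral_stepLaw [SFinite P] [SFinite m] (happ : Measurable (Function.uncurry app)) {g : W → ℝ≥0∞}
    (hg : Measurable g) : ∫⁻ w, g w ∂(stepLaw K app P m) =
      ∫⁻ x, ∫⁻ h, ∫⁻ z, g (app h z) ∂(K (x, h)) ∂m ∂P := by
  have happ' : Measurable fun w : (X × H) × Z => app w.1.2 w.2 :=
    happ.comp (by fun_prop : Measurable fun w : (X × H) × Z => (w.1.2, w.2))
  have hg' : Measurable fun w : (X × H) × Z => g (app w.1.2 w.2) := hg.comp happ'
  rw [stepLaw, lintegral_map hg happ', Measure.lintegral_compProd hg',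
    lintegral_prod _ (hg'.lintegral_kernel_prod_right' (κ := K)).aemeasurable]

lemma stepLaw_isProbabilityMeasure (happ : Measurable (Function.uncurry app))
    [IsProbabilityMeasure P] [IsProbabilityMeasure m] :
    IsProbabilityMeasure (stepLaw K app P m) :=
  Measure.isProbabilityMeasure_map
    (happ.comp (by fun_prop : Measurable fun w : (X × H) × Z => (w.1.2, w.2))).aemeasurable

lemma stepLaw_mixture [SFinite A] [SFinite B] [SFinite m]
    (happ : Measurable (Function.uncurry app)) (t : ℝ) :
    stepLaw K app (mixture A B t) m =
      mixture (stepLaw K app A m) (stepLaw K app B m) t := by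
  have : SFinite (mixture A B t) := by unfold mixture; infer_instance
  ext s hs
  have hg : Measurable (s.indicator (1 : W → ℝ≥0∞)) := measurable_one.indicator hs
  simp only [mixture, Measure.add_apply, Measure.smul_apply]
  simp only [← lintegral_indicator_one hs]
  change ∫⁻ _, _ ∂(stepLaw K app (mixture A B t) m) = _
  simp only [lintegral_stepLaw happ hg]
  simp only [mixture, lintegral_add_measure, lintegral_smul_measure]

/-- A density in the old transcript alone is constant while the new sample and output are drawn, so
it factors out. -/
lemma stepLaw_withDensity [SFinite P] [SFinite m]
    (happ : Measurable (Function.uncurry app)) (hinit : Measurable init)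
    (hia : ∀ h z, init (app h z) = h) {f : H → ℝ≥0∞} (hf : Measurable f)
    [SFinite (m.withDensity f)] :
    stepLaw K app P (m.withDensity f) = (stepLaw K app P m).withDensity (f ∘ init) := by
  ext s hs
  have hg : Measurable (s.indicator (1 : W → ℝ≥0∞)) := measurable_one.indicator hs
  have hfi : Measurable (f ∘ init) := hf.comp hinit
  rw [← lintegral_indicator_one hs, ← lintegral_indicator_one hs,
    lintegral_withDensity_eq_lintegral_mul _ hfi hg, lintegral_stepLaw happ hg,
    lintegral_stepLaw happ (hfi.mul hg)]
  refine lintegral_congr fun x => ?_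
  have happ' : Measurable fun w : H × Z => s.indicator (1 : W → ℝ≥0∞) (app w.1 w.2) :=
    hg.comp happ
  have hin : Measurable fun h => ∫⁻ z, s.indicator (1 : W → ℝ≥0∞) (app h z) ∂(K (x, h)) := by
    have := happ'.lintegral_kernel_prod_right'
      (κ := K.comap (fun h => (x, h)) (by fun_prop))
    simpa using this
  rw [lintegral_withDensity_eq_lintegral_mul _ hf hin]
  refine lintegral_congr fun h => ?_
  simp only [Pi.mul_apply, Function.comp_apply, hia]
  rw [lintegral_const_mul]
  exact hg.comp (happ.comp (by fun_prop : Measurable fun z : Z => (h, z)))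

/-- The new output integrates out to total mass one. Hence the law of the past does not depend on
the sample distribution, which is what kills the cross term later. -/
lemma map_stepLaw [IsProbabilityMeasure A] [SFinite m]
    (happ : Measurable (Function.uncurry app)) (hinit : Measurable init)
    (hia : ∀ h z, init (app h z) = h) : (stepLaw K app A m).map init = m := by
  ext s hs
  have hg : Measurable (s.indicator (1 : H → ℝ≥0∞)) := measurable_one.indicator hs
  rw [← lintegral_indicator_one hs, ← lintegral_indicator_one hs, lintegral_map hg hinit]
  have hg' : Measurable fun w => s.indicator (1 : H → ℝ≥0∞) (init w) := hg.comp hinit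
  rw [lintegral_stepLaw happ hg']
  simp [hia]

/-- The privacy inequality holds for every pair x, x', so it survives averaging over x from A and x'
from B independently. -/
lemma stepLaw_le_of_ldp [IsProbabilityMeasure A] [IsProbabilityMeasure B] [SFinite m]
    (happ : Measurable (Function.uncurry app)) {c : ℝ≥0∞} (hc : c ≠ ∞)
    (hldp : ∀ h x x' S, MeasurableSet S → K (x, h) S ≤ c * K (x', h) S)
    {s : Set W} (hs : MeasurableSet s) :
    stepLaw K app A m s ≤ c * stepLaw K app B m s := by
  have hg : Measurable (s.indicator (1 : W → ℝ≥0∞)) := measurable_one.indicator hs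
  rw [← lintegral_indicator_one hs, ← lintegral_indicator_one hs, lintegral_stepLaw happ hg,
    lintegral_stepLaw happ hg]
  set G : X → ℝ≥0∞ := fun x => ∫⁻ h, ∫⁻ z, s.indicator (1 : W → ℝ≥0∞) (app h z) ∂(K (x, h)) ∂m
  have hG : ∀ x x', G x ≤ c * G x' := fun x x' => by
    simp only [G]
    rw [← lintegral_const_mul' _ _ hc]
    refine lintegral_mono fun h => ?_
    have hS : MeasurableSet ((fun z => app h z) ⁻¹' s) :=
      (happ.comp (by fun_prop : Measurable fun z : Z => (h, z))) hs
    have key : ∀ y, ∫⁻ z, s.indicator (1 : W → ℝ≥0∞) (app h z) ∂(K (y, h)) =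
        K (y, h) ((fun z => app h z) ⁻¹' s) := fun y => by
      rw [← lintegral_indicator_one hS]; rfl
    simp only [key]
    exact hldp h x x' _ hS
  calc ∫⁻ x, G x ∂A = ∫⁻ _, ∫⁻ x, G x ∂A ∂B := by simp
    _ ≤ ∫⁻ x', c * G x' ∂B := lintegral_mono fun x' => by
        calc ∫⁻ x, G x ∂A ≤ ∫⁻ _, c * G x' ∂A := lintegral_mono fun x => hG x x'
          _ = c * G x' := by simp
    _ = c * ∫⁻ x', G x' ∂B := lintegral_const_mul' _ _ hc

end Step

lemma integrable_of_measurable_of_abs_le {Ω : Type*} [MeasurableSpace Ω] {μ : Measure Ω}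
    [IsFiniteMeasure μ] {f : Ω → ℝ} (hf : Measurable f) (C : ℝ) (hC : ∀ x, |f x| ≤ C) :
    Integrable f μ :=
  Integrable.of_bound hf.aestronglyMeasurable C (Filter.Eventually.of_forall hC)

lemma integral_withDensity_ofReal {Ω : Type*} [MeasurableSpace Ω] {μ : Measure Ω}
    {f : Ω → ℝ} (hf : Measurable f) (h0 : ∀ x, 0 ≤ f x) (g : Ω → ℝ) :
    ∫ x, g x ∂(μ.withDensity fun x => ENNReal.ofReal (f x)) = ∫ x, f x * g x ∂μ := by
  rw [integral_withDensity_eq_integral_toReal_smul (by fun_prop) (by simp)]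
  simp [ENNReal.toReal_ofReal (h0 _)]

/-! ### Second-moment growth per user -/

section Step

variable {X : Type*} {H : Type*} {Z : Type*} {W : Type*} [MeasurableSpace X] [MeasurableSpace H]
  [MeasurableSpace Z] [MeasurableSpace W] {K : Kernel (X × H) Z} [IsMarkovKernel K]
  {app : H → Z → W} {init : W → H} {A B : Measure X} {m : Measure H}

/-- One user of an `ε`-LDP protocol multiplies the second moment of the likelihood ratio between
two mixtures of `A` and `B` by at most `1 + 4 t² Υ_ε`. -/
lemma exists_density_stepLaw [IsProbabilityMeasure A] [IsProbabilityMeasure B]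
    [IsProbabilityMeasure m] (happ : Measurable (Function.uncurry app)) (hinit : Measurable init)
    (hia : ∀ h z, init (app h z) = h) {ε : ℝ} (hε : 0 ≤ ε)
    (hldp : ∀ h x x' S, MeasurableSet S →
      K (x, h) S ≤ ENNReal.ofReal (Real.exp ε) * K (x', h) S)
    {t : ℝ} (ht : |t| ≤ 1 / 2) {f : H → ℝ} (hf : Measurable f) (hf0 : ∀ h, 0 ≤ f h) {C : ℝ}
    (hfC : ∀ h, f h ≤ C) :
    ∃ f' : W → ℝ, Measurable f' ∧ (∀ w, 0 ≤ f' w) ∧ (∀ w, f' w ≤ C * 2) ∧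
      stepLaw K app (mixture A B t) (m.withDensity fun h => ENNReal.ofReal (f h)) =
        (stepLaw K app (mixture A B 0) m).withDensity (fun w => ENNReal.ofReal (f' w)) ∧
      ∫ w, f' w ^ 2 ∂(stepLaw K app (mixture A B 0) m) ≤
        (1 + 4 * t ^ 2 * Upsilon ε) * ∫ h, f h ^ 2 ∂m := by
  have hA := stepLaw_isProbabilityMeasure (K := K) (P := A) (m := m) happ
  have hB := stepLaw_isProbabilityMeasure (K := K) (P := B) (m := m) happ
  have hM0 := mixture_isProbabilityMeasure A B (t := 0) (by norm_num)
  have hM := mixture_isProbabilityMeasure A B ht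
  have hρ := stepLaw_isProbabilityMeasure (K := K) (P := mixture A B 0) (m := m) happ
  obtain ⟨d, hd, hdb, hmix⟩ := exists_mixture_eq_withDensity
    (stepLaw K app A m) (stepLaw K app B m) (Real.one_le_exp hε)
    (fun s hs => stepLaw_le_of_ldp happ ENNReal.ofReal_ne_top hldp hs)
    (fun s hs => stepLaw_le_of_ldp happ ENNReal.ofReal_ne_top hldp hs)
  rw [← stepLaw_mixture happ] at hmix
  set ρ := stepLaw K app (mixture A B 0) m with hρdef
  set q := (Real.exp ε - 1) / (Real.exp ε + 1) with hq
  have hexp := Real.one_le_exp hε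
  have hq1 : q ≤ 1 := by rw [hq, div_le_one (by linarith)]; linarith
  have hU : Upsilon ε = q ^ 2 := rfl
  have htd : ∀ s : ℝ, |s| ≤ 1 / 2 → ∀ w, |s * d w| ≤ 1 := fun s hs w => by
    rw [abs_mul]
    have := mul_le_mul hs ((hdb w).trans (by linarith : 2 * q ≤ 2)) (abs_nonneg _) (by norm_num)
    linarith
  have hC : 0 ≤ C := by
    obtain ⟨h⟩ := nonempty_of_isProbabilityMeasure m
    exact (hf0 h).trans (hfC h)
  set F : W → ℝ := fun w => f (init w) with hF
  have hFm : Measurable F := hf.comp hinit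
  -- Old likelihood ratio times the new factor, which lies in [0, 2]; the resulting uniform bound
  -- serves only integrability.
  refine ⟨fun w => F w * (1 + t * d w), by fun_prop, fun w => ?_, fun w => ?_, ?_, ?_⟩
  · have := (abs_le.mp (htd t ht w)).1
    exact mul_nonneg (hf0 _) (by linarith)
  · have := (abs_le.mp (htd t ht w))
    exact mul_le_mul (hfC _) (by linarith) (by linarith) hC
  · rw [stepLaw_withDensity happ hinit hia (by fun_prop), stepLaw_mixture happ, hmix t ht,
      ← withDensity_mul _ (by fun_prop) (by fun_prop)]
    congr 1
    ext w
    simp only [Pi.mul_apply, Function.comp_apply]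
    rw [mul_comm, ENNReal.ofReal_mul (hf0 _)]
  · have hmoment : ∀ P : Measure X, IsProbabilityMeasure P →
        ∫ w, F w ^ 2 ∂(stepLaw K app P m) = ∫ h, f h ^ 2 ∂m := fun P _ => by
      conv_rhs => rw [← map_stepLaw (K := K) (A := P) (m := m) happ hinit hia]
      rw [integral_map hinit.aemeasurable (by fun_prop)]
    have hF2 : ∀ w, |F w ^ 2| ≤ C ^ 2 := fun w => by
      rw [abs_of_nonneg (sq_nonneg _)]
      exact pow_le_pow_left₀ (hf0 _) (hfC _) 2
    have hd2 : ∀ w, |d w| ≤ 2 := fun w => (hdb w).trans (by linarith)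
    have hi1 : Integrable (fun w => F w ^ 2) ρ :=
      integrable_of_measurable_of_abs_le (by fun_prop) _ hF2
    have hi2 : Integrable (fun w => F w ^ 2 * d w) ρ :=
      integrable_of_measurable_of_abs_le (by fun_prop) (C ^ 2 * 2) fun w => by
        rw [abs_mul]; exact mul_le_mul (hF2 w) (hd2 w) (abs_nonneg _) (sq_nonneg _)
    -- At t = 1/2 the mixture is B. Since F² has the same integral under the laws built from B and
    -- from the balanced mixture, its correlation with d vanishes.
    have hcross : ∫ w, F w ^ 2 * d w ∂ρ = 0 := by
      have h := hmoment B inferInstance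
      rw [← mixture_half (stepLaw K app A m) (stepLaw K app B m), hmix _ (by norm_num),
        integral_withDensity_ofReal (by fun_prop) fun w => by
          have := (abs_le.mp (htd (1 / 2) (by norm_num) w)).1
          linarith] at h
      rw [← hmoment (mixture A B 0) hM0] at h
      have heq : ∀ w, (1 + 1 / 2 * d w) * F w ^ 2 = F w ^ 2 + 1 / 2 * (F w ^ 2 * d w) :=
        fun w => by ring
      simp only [heq] at h
      rw [integral_add hi1 (hi2.const_mul _), integral_const_mul] at h
      linarith
    have hle : ∀ w, (F w * (1 + t * d w)) ^ 2 ≤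
        (1 + 4 * t ^ 2 * Upsilon ε) * F w ^ 2 + 2 * t * (F w ^ 2 * d w) := fun w => by
      have h2 : d w ^ 2 ≤ 4 * q ^ 2 := by
        have := pow_le_pow_left₀ (abs_nonneg _) (hdb w) 2
        rw [sq_abs] at this
        linarith
      have h3 := mul_le_mul_of_nonneg_left h2 (mul_nonneg (sq_nonneg t) (sq_nonneg (F w)))
      rw [hU]
      linarith
    calc ∫ w, (F w * (1 + t * d w)) ^ 2 ∂ρ
        ≤ ∫ w, (1 + 4 * t ^ 2 * Upsilon ε) * F w ^ 2 + 2 * t * (F w ^ 2 * d w) ∂ρ :=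
          integral_mono_of_nonneg (Filter.Eventually.of_forall fun w => sq_nonneg _)
            ((hi1.const_mul _).add (hi2.const_mul _)) (Filter.Eventually.of_forall hle)
      _ = (1 + 4 * t ^ 2 * Upsilon ε) * ∫ h, f h ^ 2 ∂m := by
          rw [integral_add (hi1.const_mul _) (hi2.const_mul _), integral_const_mul,
            integral_const_mul, hcross, hmoment _ hM0]
          ring

end Step

/-! ### Induction over the users -/

namespace SeqLDPProtocol

variable {X : Type v} [MeasurableSpace X] {n : ℕ} {ε : ℝ} (M : SeqLDPProtocol.{u, v} X n ε)

lemma measurable_append (i : ℕ) (hi : i + 1 ≤ n) :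
    Measurable (Function.uncurry (M.append i hi)) := by
  refine measurable_pi_lambda _ fun j => ?_
  induction j using Fin.lastCases with
  | last =>
    simp only [Function.uncurry, append, Fin.snoc_last]
    exact measurable_snd
  | cast j =>
    simp only [Function.uncurry, append, Fin.snoc_castSucc]
    exact (measurable_pi_apply j).comp measurable_fst

lemma measurable_init (i : ℕ) (hi : i + 1 ≤ n) :
    Measurable (fun (w : M.Transcript (i + 1) hi) =>
      (fun j => w j.castSucc : M.Transcript i (Nat.le_of_succ_le hi))) :=
  measurable_pi_lambda _ fun j => measurable_pi_apply j.castSucc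

lemma init_append (i : ℕ) (hi : i + 1 ≤ n) (h : M.Transcript i (Nat.le_of_succ_le hi))
    (z : M.Z ⟨i, hi⟩) :
    (fun j => M.append i hi h z j.castSucc : M.Transcript i (Nat.le_of_succ_le hi)) = h := by
  funext j
  simp [append]

lemma law_succ (P : Measure X) (i : ℕ) (hi : i + 1 ≤ n) :
    M.law P (i + 1) hi =
      stepLaw (M.K ⟨i, hi⟩) (M.append i hi) P (M.law P i (Nat.le_of_succ_le hi)) := rfl

lemma law_isProbabilityMeasure (P : Measure X) [IsProbabilityMeasure P] (i : ℕ) (hi : i ≤ n) :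
    IsProbabilityMeasure (M.law P i hi) := by
  induction i with
  | zero => exact Measure.dirac.isProbabilityMeasure
  | succ i ih =>
    have := ih (Nat.le_of_succ_le hi)
    have := M.isMarkovKernel ⟨i, hi⟩
    rw [law_succ]
    exact stepLaw_isProbabilityMeasure (M.measurable_append i hi)

/-- Tensorized chi-square bound for the law of the transcript of an `ε`-LDP protocol. -/
lemma exists_density_law (hε : 0 ≤ ε) (A B : Measure X) [IsProbabilityMeasure A]
    [IsProbabilityMeasure B] {t : ℝ} (ht : |t| ≤ 1 / 2) (i : ℕ) (hi : i ≤ n) :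
    ∃ f : M.Transcript i hi → ℝ, Measurable f ∧ (∀ h, 0 ≤ f h) ∧ (∀ h, f h ≤ 2 ^ i) ∧
      M.law (mixture A B t) i hi =
        (M.law (mixture A B 0) i hi).withDensity (fun h => ENNReal.ofReal (f h)) ∧
      ∫ h, f h ^ 2 ∂(M.law (mixture A B 0) i hi) ≤ (1 + 4 * t ^ 2 * Upsilon ε) ^ i := by
  have hM0 := mixture_isProbabilityMeasure A B (t := 0) (by norm_num)
  induction i with
  | zero =>
    refine ⟨fun _ => 1, measurable_const, fun _ => zero_le_one, fun _ => by simp, ?_, ?_⟩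
    · simp only [ENNReal.ofReal_one]
      exact (withDensity_one (μ := M.law (mixture A B 0) 0 hi)).symm
    · have := M.law_isProbabilityMeasure (mixture A B 0) 0 hi
      simp
  | succ i ih =>
    obtain ⟨f, hf, hf0, hfC, hlaw, hmom⟩ := ih (Nat.le_of_succ_le hi)
    have := M.law_isProbabilityMeasure (mixture A B 0) i (Nat.le_of_succ_le hi)
    have := M.isMarkovKernel ⟨i, hi⟩
    obtain ⟨f', hf', hf'0, hf'C, hlaw', hmom'⟩ := exists_density_stepLaw (K := M.K ⟨i, hi⟩)
      (A := A) (B := B) (m := M.law (mixture A B 0) i (Nat.le_of_succ_le hi))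
      (M.measurable_append i hi) (M.measurable_init i hi) (M.init_append i hi) hε
      (fun h x x' S hS => M.ldp ⟨i, hi⟩ h x x' S hS) ht hf hf0 hfC
    refine ⟨f', hf', hf'0, fun w => (hf'C w).trans_eq (pow_succ _ _).symm, ?_, ?_⟩
    · rw [law_succ, law_succ, hlaw, hlaw']
    · rw [law_succ, pow_succ']
      refine hmom'.trans (mul_le_mul_of_nonneg_left hmom ?_)
      have : 0 ≤ Upsilon ε := sq_nonneg _
      positivity

end SeqLDPProtocol

/-! ### Two-point bound -/

/-- Two-point lower bound for the squared loss in terms of the second moment of the likelihood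
ratio. -/
lemma two_point_lower_bound {Ω : Type*} [MeasurableSpace Ω] {μ : Measure Ω}
    [IsProbabilityMeasure μ] {f : Ω → ℝ} (hf : Measurable f) (hf0 : ∀ x, 0 ≤ f x) {C : ℝ}
    (hfC : ∀ x, f x ≤ C)
    (hν : IsProbabilityMeasure (μ.withDensity fun x => ENNReal.ofReal (f x))) {η : ℝ}
    (hη : ∫ x, f x ^ 2 ∂μ ≤ 1 + η) {ψ : Ω → ℝ} (hψ : Measurable ψ) (a b : ℝ) :
    ENNReal.ofReal ((a - b) ^ 2 * (1 / 2 - η / 4)) ≤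
      ∫⁻ x, ENNReal.ofReal ((ψ x - a) ^ 2) ∂μ +
        ∫⁻ x, ENNReal.ofReal ((ψ x - b) ^ 2) ∂(μ.withDensity fun x => ENNReal.ofReal (f x)) := by
  have hif : Integrable f μ := integrable_of_measurable_of_abs_le hf C fun x => by
    rw [abs_of_nonneg (hf0 x)]; exact hfC x
  have hif2 : Integrable (fun x => f x ^ 2) μ :=
    integrable_of_measurable_of_abs_le (by fun_prop) (C ^ 2) fun x => by
      rw [abs_of_nonneg (sq_nonneg _)]
      exact pow_le_pow_left₀ (hf0 x) (hfC x) 2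
  have hone : ∫ x, f x ∂μ = 1 := by
    have h := integral_withDensity_ofReal (μ := μ) hf hf0 (fun _ => (1 : ℝ))
    simpa using h.symm
  rw [lintegral_withDensity_eq_lintegral_mul _ (by fun_prop) (by fun_prop),
    ← lintegral_add_left (by fun_prop)]
  -- Minimizing (y - a)² + f (y - b)² over y gives (a - b)² f/(1 + f), and 3f/4 - f²/4 is a minorant
  -- of f/(1 + f) tangent at f = 1.
  set g : Ω → ℝ := fun x => (a - b) ^ 2 * (3 / 4 * f x - f x ^ 2 / 4) with hg
  have hig : Integrable g μ := ((hif.const_mul _).sub (hif2.div_const _)).const_mul _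
  have hgint : (a - b) ^ 2 * (1 / 2 - η / 4) ≤ ∫ x, g x ∂μ := by
    rw [hg, integral_const_mul, integral_sub (hif.const_mul _) (hif2.div_const _),
      integral_const_mul, integral_div, hone]
    exact mul_le_mul_of_nonneg_left (by linarith) (sq_nonneg _)
  -- g is negative where f > 3 and a ≠ b, so its positive part is used to pass to the Lebesgue
  -- integral.
  have hpos : ∫ x, g x ∂μ ≤ ∫ x, max (g x) 0 ∂μ :=
    integral_mono hig hig.pos_part fun x => le_max_left _ _
  refine (ENNReal.ofReal_le_ofReal (hgint.trans hpos)).trans ?_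
  rw [ofReal_integral_eq_lintegral_ofReal hig.pos_part
    (Filter.Eventually.of_forall fun x => le_max_right _ _)]
  refine lintegral_mono fun x => ?_
  simp only [Pi.mul_apply]
  rw [← ENNReal.ofReal_mul (hf0 x),
    ← ENNReal.ofReal_add (sq_nonneg _) (mul_nonneg (hf0 x) (sq_nonneg _))]
  refine ENNReal.ofReal_le_ofReal (max_le ?_
    (add_nonneg (sq_nonneg _) (mul_nonneg (hf0 x) (sq_nonneg _))))
  have h1 : 0 < 1 + f x := by linarith [hf0 x]
  -- The gap is (a - b)² f (f - 1)²/4.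
  have h2 : (1 + f x) * ((a - b) ^ 2 * (3 / 4 * f x - f x ^ 2 / 4)) ≤
      (a - b) ^ 2 * f x := by
    have h := mul_nonneg (sq_nonneg (a - b)) (mul_nonneg (hf0 x) (sq_nonneg (f x - 1)))
    linarith
  have h3 : (a - b) ^ 2 * f x ≤ (1 + f x) * ((ψ x - a) ^ 2 + f x * (ψ x - b) ^ 2) := by
    have h := sq_nonneg ((ψ x - a) + f x * (ψ x - b))
    linarith
  exact le_of_mul_le_mul_left (h2.trans h3) h1

/-! ### The hard one-parameter family -/

/-- The parameter which gives mass `p` to the last point and spreads the rest uniformly. -/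
noncomputable def lastMassParam (m : ℕ) (p : ℝ) : Fin m → ℝ := fun _ => (1 - p) / m

section LastMass

variable {m : ℕ} {p : ℝ}

lemma sum_lastMassParam (hm : m ≠ 0) : ∑ i, lastMassParam m p i = 1 - p := by
  have : (m : ℝ) ≠ 0 := by exact_mod_cast hm
  simp only [lastMassParam, Finset.sum_const, Finset.card_univ, Fintype.card_fin, nsmul_eq_mul]
  field_simp

lemma lastMassParam_mem (hm : m ≠ 0) (h0 : 0 ≤ p) (h1 : p ≤ 1) :
    lastMassParam m p ∈ simplexParam (m + 1) := by
  have hm1 : (1 : ℝ) ≤ m := by exact_mod_cast Nat.one_le_iff_ne_zero.mpr hm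
  refine ⟨fun i => ⟨div_nonneg (by linarith) (by linarith), ?_⟩, ?_⟩
  · exact (div_le_one (by linarith)).mpr (by linarith)
  · exact (sum_lastMassParam hm).trans_le (by linarith)

lemma probVec_lastMassParam_castSucc (i : Fin m) :
    probVec (m + 1) (lastMassParam m p) i.castSucc = (1 - p) / m := by
  simp [probVec, lastMassParam]

lemma probVec_lastMassParam_last (hm : m ≠ 0) (h0 : 0 ≤ p) :
    probVec (m + 1) (lastMassParam m p) (Fin.last m) = p := by
  have h : ∑ i : Fin (m + 1 - 1), lastMassParam m p i = 1 - p := sum_lastMassParam hm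
  rw [probVec, dif_neg (by simp), h]
  simpa using h0

lemma discreteDist_lastMassParam_isProbabilityMeasure (hm : m ≠ 0) (h0 : 0 ≤ p) (h1 : p ≤ 1) :
    IsProbabilityMeasure (discreteDist (m + 1) (lastMassParam m p)) := by
  have hm0 : (m : ℝ) ≠ 0 := by exact_mod_cast hm
  have hq : 0 ≤ (1 - p) / m := div_nonneg (by linarith) (Nat.cast_nonneg _)
  constructor
  simp only [discreteDist, Measure.finsetSum_apply, Measure.smul_apply, measure_univ,
    smul_eq_mul, mul_one]
  rw [Fin.sum_univ_castSucc, probVec_lastMassParam_last hm h0]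
  simp only [probVec_lastMassParam_castSucc, Finset.sum_const, Finset.card_univ,
    Fintype.card_fin]
  rw [← ENNReal.ofReal_nsmul, ← ENNReal.ofReal_add (nsmul_nonneg hq _) h0, nsmul_eq_mul,
    mul_div_cancel₀ _ hm0]
  norm_num

/-- The probability vector is affine in the last mass, so the family is the segment between the
uniform law on the first m points and the point mass at the last. -/
lemma discreteDist_lastMassParam_eq_mixture (hm : m ≠ 0) {t : ℝ} (ht : |t| ≤ 1 / 2) :
    discreteDist (m + 1) (lastMassParam m (1 / 2 + t)) =
      mixture (discreteDist (m + 1) (lastMassParam m 0))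
        (discreteDist (m + 1) (lastMassParam m 1)) t := by
  obtain ⟨h1, h2⟩ := abs_le.mp ht
  simp only [discreteDist, mixture, Finset.smul_sum, smul_smul, ← Finset.sum_add_distrib,
    ← add_smul]
  refine Finset.sum_congr rfl fun j _ => ?_
  congr 1
  induction j using Fin.lastCases with
  | last =>
    rw [probVec_lastMassParam_last hm (by linarith), probVec_lastMassParam_last hm le_rfl,
      probVec_lastMassParam_last hm zero_le_one]
    simp
  | cast j =>
    simp only [probVec_lastMassParam_castSucc]
    rw [← ENNReal.ofReal_mul (by linarith)]
    simp only [sub_self, zero_div, ENNReal.ofReal_zero, mul_zero, add_zero]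
    congr 1; ring

lemma entropyFunctional_lastMassParam (hm : m ≠ 0) (h0 : 0 ≤ p) :
    entropyFunctional (m + 1) (lastMassParam m p) =
      Real.binEntropy p + (1 - p) * Real.log m := by
  have hm0 : (m : ℝ) ≠ 0 := by exact_mod_cast hm
  rw [entropyFunctional, Fin.sum_univ_castSucc, probVec_lastMassParam_last hm h0]
  simp only [probVec_lastMassParam_castSucc, Finset.sum_const, Finset.card_univ,
    Fintype.card_fin, nsmul_eq_mul, Real.binEntropy, Real.log_inv]
  rw [← mul_assoc, mul_div_cancel₀ _ hm0]
  rcases eq_or_ne (1 - p) 0 with h | h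
  · rw [h]; ring
  · rw [Real.log_div h hm0]; ring

/-- The binary entropy attains its maximum log 2 at 1/2, so its change only helps and the linear
term (1 - p) log m gives the separation. -/
lemma le_entropyFunctional_sub (hm : m ≠ 0) {t : ℝ} (ht : 0 ≤ t) :
    t * Real.log m ≤ entropyFunctional (m + 1) (lastMassParam m (1 / 2 + 0)) -
      entropyFunctional (m + 1) (lastMassParam m (1 / 2 + t)) := by
  rw [entropyFunctional_lastMassParam hm (by norm_num),
    entropyFunctional_lastMassParam hm (by linarith), add_zero, one_div, Real.binEntropy_two_inv]
  have := Real.binEntropy_le_log_two (p := 2⁻¹ + t)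
  linarith

end LastMass

/-! ### Choice of parameters and conclusion -/

/-- Any private protocol and estimator suffer a risk of order `s log² m`, as long as
`s n Υ_ε ≤ 1/100`. -/
lemma le_privateMinimaxRisk {m n : ℕ} (hm : m ≠ 0) {ε : ℝ} (hε : 0 ≤ ε) {s : ℝ} (hs0 : 0 ≤ s)
    (hs1 : s ≤ 1) (hs : s * (n * Upsilon ε) ≤ 1 / 100) :
    ENNReal.ofReal (1 / 20 * s * Real.log m ^ 2) ≤
      privateMinimaxRisk.{u, 0, 0} n (simplexParam (m + 1)) (discreteDist (m + 1))
        (entropyFunctional (m + 1)) squaredLoss ε := by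
  have hU : 0 ≤ Upsilon ε := sq_nonneg _
  set t := √s / 2 with ht
  have ht0 : 0 ≤ t := by positivity
  have ht2 : 4 * t ^ 2 = s := by rw [ht, div_pow, Real.sq_sqrt hs0]; ring
  have ht1 : t ≤ 1 / 2 := by
    have : √s ≤ 1 := Real.sqrt_le_one.mpr hs1
    linarith
  have htabs : |t| ≤ 1 / 2 := by rwa [abs_of_nonneg ht0]
  refine le_iInf fun M => le_iInf fun ψ => le_iInf fun hψ => ?_
  set R : (Fin (m + 1 - 1) → ℝ) → ℝ≥0∞ := fun θ => ∫⁻ z, ENNReal.ofReal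
    (squaredLoss (ψ z) (entropyFunctional (m + 1) θ)) ∂(M.law (discreteDist (m + 1) θ) n le_rfl)
    with hR
  have hsup : ∀ r : ℝ, 0 ≤ r → r ≤ 1 / 2 → R (lastMassParam m (1 / 2 + r)) ≤
      ⨆ θ ∈ simplexParam (m + 1), R θ := fun r h0 h1 =>
    le_iSup₂_of_le _ (lastMassParam_mem hm (by linarith) (by linarith)) le_rfl
  have hA := discreteDist_lastMassParam_isProbabilityMeasure (p := 0) hm le_rfl zero_le_one
  have hB := discreteDist_lastMassParam_isProbabilityMeasure (p := 1) hm zero_le_one le_rfl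
  obtain ⟨f, hf, hf0, hfC, hlaw, hmom⟩ := M.exists_density_law hε
    (discreteDist (m + 1) (lastMassParam m 0)) (discreteDist (m + 1) (lastMassParam m 1))
    htabs n le_rfl
  rw [← discreteDist_lastMassParam_eq_mixture hm htabs,
    ← discreteDist_lastMassParam_eq_mixture hm (by norm_num)] at hlaw
  rw [← discreteDist_lastMassParam_eq_mixture hm (by norm_num)] at hmom
  have hP0 := discreteDist_lastMassParam_isProbabilityMeasure (p := 1 / 2 + 0) hm
    (by norm_num) (by norm_num)
  have hPt := discreteDist_lastMassParam_isProbabilityMeasure (p := 1 / 2 + t) hm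
    (by linarith) (by linarith)
  have hμ := M.law_isProbabilityMeasure (discreteDist (m + 1) (lastMassParam m (1 / 2 + 0)))
    n le_rfl
  have hν := M.law_isProbabilityMeasure (discreteDist (m + 1) (lastMassParam m (1 / 2 + t)))
    n le_rfl
  rw [hlaw] at hν
  -- The power is at most exp(1/100) ≤ 1/(1 - 1/100) = 100/99.
  have hη : (1 + 4 * t ^ 2 * Upsilon ε) ^ n ≤ 1 + 1 / 50 := by
    have h1 : (1 + 4 * t ^ 2 * Upsilon ε) ^ n ≤ Real.exp (4 * t ^ 2 * Upsilon ε) ^ n :=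
      pow_le_pow_left₀ (by positivity)
        (by linarith [Real.add_one_le_exp (4 * t ^ 2 * Upsilon ε)]) n
    rw [← Real.exp_nat_mul, ht2] at h1
    have h2 : Real.exp (n * (s * Upsilon ε)) ≤ Real.exp (1 / 100) :=
      Real.exp_le_exp.mpr (by linarith)
    have h3 := Real.exp_bound_div_one_sub_of_interval (x := 1 / 100) (by norm_num) (by norm_num)
    rw [ht2]
    refine (h1.trans h2).trans (h3.trans (by norm_num))
  have htwo := two_point_lower_bound hf hf0 hfC hν (hmom.trans hη) hψ
    (entropyFunctional (m + 1) (lastMassParam m (1 / 2 + 0)))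
    (entropyFunctional (m + 1) (lastMassParam m (1 / 2 + t)))
  rw [← hlaw] at htwo
  -- The supremum dominates both risks. With η = 1/50 and t² = s/4 the two-point constant is
  -- 0.495/4, which exceeds 2/20.
  have hsum : ENNReal.ofReal (2 * (1 / 20 * s * Real.log m ^ 2)) ≤
      2 * ⨆ θ ∈ simplexParam (m + 1), R θ := by
    refine (ENNReal.ofReal_le_ofReal ?_).trans (htwo.trans ?_)
    · have hL : 0 ≤ Real.log m := Real.log_natCast_nonneg m
      have h := pow_le_pow_left₀ (mul_nonneg ht0 hL) (le_entropyFunctional_sub hm ht0) 2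
      have hL2 : 0 ≤ t ^ 2 * Real.log m ^ 2 := by positivity
      rw [← ht2]
      linarith
    · rw [two_mul]
      exact add_le_add (hsup 0 le_rfl (by norm_num)) (hsup t ht0 ht1)
  rw [ENNReal.ofReal_mul (by norm_num), ENNReal.ofReal_ofNat] at hsum
  exact (ENNReal.mul_le_mul_iff_right (by norm_num) (by norm_num)).mp hsum

theorem corollary2 (k n : ℕ) (hk : 3 ≤ k) (hn : 1 ≤ n) (ε : ℝ) (hε : 0 ≤ ε) :
    (1 / 20 : ℝ≥0∞) * min 1 (1 / (100 * (n : ℝ≥0∞) * ENNReal.ofReal (Upsilon ε))) *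
        ENNReal.ofReal (Real.log ((k : ℝ) - 1) ^ 2) ≤
      privateMinimaxRisk.{u, 0, 0} n (simplexParam k) (discreteDist k) (entropyFunctional k)
        squaredLoss ε := by
  obtain ⟨m, rfl⟩ : ∃ m, k = m + 1 := ⟨k - 1, by omega⟩
  have hm : m ≠ 0 := by omega
  have hn0 : (0 : ℝ) < n := by exact_mod_cast hn
  have hU : 0 ≤ Upsilon ε := sq_nonneg _
  obtain ⟨s, hs0, hs1, hs, hmin⟩ : ∃ s : ℝ, 0 ≤ s ∧ s ≤ 1 ∧ s * (n * Upsilon ε) ≤ 1 / 100 ∧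
      min 1 (1 / (100 * (n : ℝ≥0∞) * ENNReal.ofReal (Upsilon ε))) = ENNReal.ofReal s := by
    rcases hU.eq_or_lt with h | h
    -- When Υ_ε = 0, division by zero in `ℝ≥0∞` gives ∞, so the minimum is 1.
    · exact ⟨1, zero_le_one, le_rfl, by simp [← h], by simp [← h]⟩
    · have hpos : 0 < 100 * n * Upsilon ε := by positivity
      refine ⟨min 1 (1 / (100 * n * Upsilon ε)), by positivity, min_le_left _ _, ?_, ?_⟩
      · refine (mul_le_mul_of_nonneg_right (min_le_right _ _) (by positivity)).trans_eq ?_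
        field_simp
      · rw [ENNReal.ofReal_min, ENNReal.ofReal_one, ENNReal.ofReal_div_of_pos hpos,
          ENNReal.ofReal_mul (by positivity), ENNReal.ofReal_mul (by norm_num)]
        simp
  refine le_trans (le_of_eq ?_) (le_privateMinimaxRisk hm hε hs0 hs1 hs)
  rw [hmin, ENNReal.ofReal_mul (by positivity), ENNReal.ofReal_mul (by norm_num),
    ENNReal.ofReal_div_of_pos (by norm_num)]
  simp
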